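/- Let $X$ be a Hausdorff topological space, and let $C(X)$ be the space of continuous complex-valued functions on $X$ with the compact-open topology. A normed space of continuous functions over $X$ is a linear subspace $\mathbf F\subset C(X)$ with a norm for which the inclusion $\mathbf F\to C(X)$ is continuous. For $x\in X$ let $x_{\mathbf F}\in\mathbf F^*$ be the point evaluation $f\mapsto f(x)$; $\mathbf F$ is called $1$-independent if $x_{\mathbf F}\neq 0$ for every $x\in X$. A function $\omega:X\to\mathbb C$ is a multiplier of $\mathbf F$ if $\omega f\in\mathbf F$ for all $f\in\mathbf F$, and then $M_\omega:\mathbf F\to\mathbf F$ is the operator $M_\omega f=\omega f$. An operator is weakly compact if it maps the unit ball to a relatively weakly compact set. $\mathbf F$ has the Dunford–Pettis property if every weakly compact operator from $\mathbf F$ to a Banach space maps weakly compact sets to norm compact sets. Corollary. Let $\mathbf F$ be a (not necessarily complete) $1$-independent normed space of continuous functions over $X$ that has the Dunford–Pettis property, and let $\omega:X\to\mathbb C$ be a multiplier of $\mathbf F$ such that $M_\omega$ is weakly compact. Then $\omega^2$ is a multiplier of $\mathbf F$ and $M_\omega^2=M_{\omega^2}$ is a compact operator on $\mathbf F$. Moreover: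 - $\omega(X)$ is either finite, or the set of terms of a sequence of distinct complex numbers that converges to $0$; - $\omega^{-1}(\lambda)$ is clopen in $X$ for every $\lambda\in\mathbb C\setminus\{0\}$; - $\omega$ is constant on every connected component of $X$; - (i) if $X$ is connected and $\dim\mathbf F=\infty$, then $\omega\equiv 0$; - (ii) if the family $(x_{\mathbf F})_{x\in X}$ of point evaluations is linearly independent in $\mathbf F^*$, then $X\setminus\omega^{-1}(0)$ is an at most countable set of isolated points of $X$. -/

import Mathlib

open Set Filter Topology

/-- A normed space of continuous functions over `X`: a normed space `F` identified, through an
injective linear map `incl` which is continuous for the compact-open topology, with a linear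
subspace of the space `C(X, ℂ)` of continuous complex-valued functions on `X`. -/
class NSCF (X : Type*) [TopologicalSpace X] (F : Type*) [NormedAddCommGroup F]
    [NormedSpace ℂ F] where
  /-- The inclusion of `F` into `C(X, ℂ)` (with the compact-open topology). -/
  incl : F →L[ℂ] C(X, ℂ)
  incl_injective : Function.Injective incl

namespace NSCF

section

variable {X : Type*} [TopologicalSpace X] (F : Type*) [NormedAddCommGroup F] [NormedSpace ℂ F]
  [NSCF X F]

/-- The point evaluation at `x`, as an element of the dual of `F`. -/
noncomputable def pointEval (x : X) : StrongDual ℂ F :=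
  (ContinuousMap.evalCLM ℂ x).comp (incl (X := X) (F := F))

variable (X) in
/-- `F` is `1`-independent: no point evaluation vanishes identically on `F`. -/
def OneIndependent : Prop :=
  ∀ x : X, pointEval F x ≠ 0

/-- `ω` is a multiplier of `F`: for each `f ∈ F` the function `ω f` belongs to `F`. -/
def IsMultiplier (ω : X → ℂ) : Prop :=
  ∀ f : F, ∃ g : F, ∀ x : X, pointEval F x g = ω x * pointEval F x f

end

section

variable {X : Type*} [TopologicalSpace X] {F : Type*} [NormedAddCommGroup F] [NormedSpace ℂ F]
  [NSCF X F]

theorem ext_pointEval {f g : F} (h : ∀ x : X, pointEval F x f = pointEval F x g) : f = g :=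
  incl_injective (X := X) (ContinuousMap.ext h)

/-- The multiplication operator `M_ω : F → F` of a multiplier `ω` of `F`. -/
noncomputable def mulOp {ω : X → ℂ} (hω : IsMultiplier F ω) : F →ₗ[ℂ] F where
  toFun f := (hω f).choose
  map_add' f g := ext_pointEval (X := X) fun x => by
    rw [map_add, (hω (f + g)).choose_spec x, (hω f).choose_spec x, (hω g).choose_spec x, map_add,
      mul_add]
  map_smul' c f := ext_pointEval (X := X) fun x => by
    rw [RingHom.id_apply, map_smul, (hω (c • f)).choose_spec x, (hω f).choose_spec x, map_smul,
      smul_eq_mul, smul_eq_mul, mul_left_comm]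

theorem pointEval_mulOp {ω : X → ℂ} (hω : IsMultiplier F ω) (f : F) (x : X) :
    pointEval F x (mulOp hω f) = ω x * pointEval F x f :=
  (hω f).choose_spec x

end

end NSCF

/-- A (linear) map `T` between normed spaces is weakly compact if it maps the unit ball to a
relatively weakly compact set. -/
def IsWeaklyCompactOperator {E G : Type*} [NormedAddCommGroup E] [NormedSpace ℂ E]
    [NormedAddCommGroup G] [NormedSpace ℂ G] (T : E → G) : Prop :=
  IsCompact (closure (toWeakSpace ℂ G '' (T '' Metric.ball (0 : E) 1)))

/-- A (linear) map `T` between normed spaces is completely continuous (a Dunford–Pettis operator)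
if it maps weakly compact sets to norm compact sets. -/
def IsCompletelyContinuous {E G : Type*} [NormedAddCommGroup E] [NormedSpace ℂ E]
    [NormedAddCommGroup G] [NormedSpace ℂ G] (T : E → G) : Prop :=
  ∀ K : Set E, IsCompact (toWeakSpace ℂ E '' K) → IsCompact (T '' K)

/-- The Dunford–Pettis property: every weakly compact operator from `E` to a Banach space is
completely continuous. -/
def DunfordPettisProperty.{v} (E : Type v) [NormedAddCommGroup E] [NormedSpace ℂ E] : Prop :=
  ∀ (G : Type v) [NormedAddCommGroup G] [NormedSpace ℂ G] [CompleteSpace G] (T : E →L[ℂ] G),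
    IsWeaklyCompactOperator T → IsCompletelyContinuous T

/-! Weak compactness followed by complete continuity makes `M_ω ^ 2` compact. Each point evaluation
is an eigenvector of the adjoint of `M_ω`, with eigenvalue `ω x`, and evaluations with distinct
eigenvalues are independent. By Riesz theory a compact operator admits no infinite independent
sequence of eigenfunctionals with eigenvalues bounded away from `0`, so `ω` takes only finitely many
values outside each disc about `0`. Nonzero values are thus isolated in the range, and continuity of
`ω` makes their fibres clopen. If all evaluations are independent, the same argument counts points
instead of values. Since `F` may be incomplete, the Riesz argument runs in the dual. -/

/-- Schauder's argument for compactness of the adjoint: on a finite net of the image of the unit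
ball, bounded functionals have a convergent subsequence of value vectors. -/
theorem exists_lt_norm_sub_comp_lt {𝕜 E G : Type*} [RCLike 𝕜] [NormedAddCommGroup E]
    [NormedSpace 𝕜 E] [NormedAddCommGroup G] [NormedSpace 𝕜 G] {S : E →L[𝕜] G}
    (hS : IsCompactOperator S) {ψ : ℕ → StrongDual 𝕜 G} (hψ : ∀ n, ‖ψ n‖ ≤ 1) {ε : ℝ}
    (hε : 0 < ε) : ∃ m n, m < n ∧ ‖(ψ n - ψ m).comp S‖ < ε := by
  obtain ⟨K, hK, hSK⟩ := hS.image_closedBall_subset_compact (f := S.toLinearMap) 1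
  have hδ : 0 < ε / 8 := by positivity
  obtain ⟨t, ht, hKt⟩ := Metric.totallyBounded_iff.1 hK.totallyBounded (ε / 8) hδ
  have := ht.fintype
  let v : ℕ → (t → 𝕜) := fun n y => ψ n y
  have hv : ∀ n, v n ∈ Set.pi univ fun y : t => Metric.closedBall (0 : 𝕜) ‖(y : G)‖ := by
    intro n y _
    rw [mem_closedBall_zero_iff]
    exact (ψ n).le_of_opNorm_le (hψ n) y |>.trans (by rw [one_mul])
  obtain ⟨a, -, u, hu, hlim⟩ :=
    (isCompact_univ_pi fun y : t => isCompact_closedBall (0 : 𝕜) ‖(y : G)‖).tendsto_subseq hv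
  obtain ⟨N, hN⟩ := Metric.cauchySeq_iff.1 hlim.cauchySeq (ε / 8) hδ
  have hclose := hN (N + 1) (Nat.le_succ N) N le_rfl
  refine ⟨u N, u (N + 1), hu (Nat.lt_succ_self N), ?_⟩
  -- The bound is `2 * (ε / 8)` from the distance to the net plus `ε / 8` on the net.
  refine lt_of_le_of_lt (ContinuousLinearMap.opNorm_le_of_unit_norm (C := ε / 2) (by positivity)
    fun x hx => ?_) (half_lt_self hε)
  have hSx : S x ∈ K := hSK ⟨x, by simp [hx], rfl⟩
  obtain ⟨y, hy, hxy⟩ : ∃ y ∈ t, S x ∈ Metric.ball y (ε / 8) := by simpa using hKt hSx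
  rw [mem_ball_iff_norm] at hxy
  have h1 : ‖ψ (u (N + 1)) y - ψ (u N) y‖ < ε / 8 := by
    have := (dist_le_pi_dist _ _ (⟨y, hy⟩ : t)).trans_lt hclose
    rwa [dist_eq_norm] at this
  have h2 : ‖(ψ (u (N + 1)) - ψ (u N)) (S x - y)‖ ≤ 2 * ‖S x - y‖ :=
    (ψ (u (N + 1)) - ψ (u N)).le_of_opNorm_le
      ((norm_sub_le _ _).trans (by linarith [hψ (u (N + 1)), hψ (u N)])) _
  have h3 : ((ψ (u (N + 1)) - ψ (u N)).comp S) x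
      = (ψ (u (N + 1)) - ψ (u N)) (S x - y) + (ψ (u (N + 1)) y - ψ (u N) y) := by
    simp
    ring
  rw [h3]
  refine (norm_add_le _ _).trans ?_
  linarith

/-- The distance to a closed subspace is positive, hence nearly attained; this plays the role of
Riesz's lemma. -/
theorem exists_mem_norm_sub_le_two_mul {𝕜 E : Type*} [NormedField 𝕜] [NormedAddCommGroup E]
    [NormedSpace 𝕜 E] {p : Submodule 𝕜 E} (hp : IsClosed (p : Set E)) {x : E} (hx : x ∉ p) :
    ∃ e ∈ p, ∀ e' ∈ p, ‖x - e‖ ≤ 2 * ‖x - e'‖ := by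
  have hne : (p : Set E).Nonempty := ⟨0, p.zero_mem⟩
  have hd : 0 < Metric.infDist x p := (hp.notMem_iff_infDist_pos hne).1 hx
  obtain ⟨e, he, hlt⟩ := (Metric.infDist_lt_iff hne).1 (show Metric.infDist x p
    < 2 * Metric.infDist x p by linarith)
  refine ⟨e, he, fun e' he' => ?_⟩
  have := Metric.infDist_le_dist_of_mem (x := x) he'
  rw [dist_eq_norm] at this hlt
  linarith

/-- The eigenfunctionals of the adjoint of a compact operator, with eigenvalues bounded away from
zero, contain no infinite linearly independent sequence. -/
theorem IsCompactOperator.not_linearIndependent_of_comp_eq_smul {𝕜 E : Type*} [RCLike 𝕜]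
    [NormedAddCommGroup E] [NormedSpace 𝕜 E] {S : E →L[𝕜] E} (hS : IsCompactOperator S)
    {φ : ℕ → StrongDual 𝕜 E} {μ : ℕ → 𝕜} (hφ : ∀ n, (φ n).comp S = μ n • φ n) {ε : ℝ}
    (hε : 0 < ε) (hμ : ∀ n, ε ≤ ‖μ n‖) : ¬ LinearIndependent 𝕜 φ := by
  intro hli
  let p : ℕ → Submodule 𝕜 (StrongDual 𝕜 E) := fun n => Submodule.span 𝕜 (φ '' Iio n)
  have hmono : Monotone p := fun m n h => Submodule.span_mono (image_mono (Iio_subset_Iio h))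
  have hmem : ∀ n, φ n ∈ p (n + 1) := fun n =>
    Submodule.subset_span ⟨n, Nat.lt_succ_self n, rfl⟩
  have hclosed : ∀ n, IsClosed (p n : Set (StrongDual 𝕜 E)) := fun n => by
    have : FiniteDimensional 𝕜 (p n) := FiniteDimensional.span_of_finite 𝕜
      ((finite_Iio n).image φ)
    exact Submodule.closed_of_finiteDimensional (p n)
  have hinv : ∀ n, ∀ e ∈ p n, e.comp S ∈ p n := fun n e he => by
    induction he using Submodule.span_induction with
    | mem e he =>
      obtain ⟨k, hk, rfl⟩ := he
      rw [hφ]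
      exact Submodule.smul_mem _ _ (Submodule.subset_span ⟨k, hk, rfl⟩)
    | zero => simp
    | add a b _ _ ha hb => rw [ContinuousLinearMap.add_comp]; exact add_mem ha hb
    | smul c a _ ha => rw [ContinuousLinearMap.smul_comp]; exact Submodule.smul_mem _ _ ha
  have hnot : ∀ n, φ n ∉ p n := fun n => hli.notMem_span_image (by simp)
  choose e he hbest using fun n => exists_mem_norm_sub_le_two_mul (hclosed n) (hnot n)
  have hpos : ∀ n, 0 < ‖φ n - e n‖ := fun n =>
    norm_pos_iff.2 (sub_ne_zero.2 fun h => hnot n (h ▸ he n))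
  let c : ℕ → 𝕜 := fun n => ((‖φ n - e n‖⁻¹ : ℝ) : 𝕜)
  have hc : ∀ n, ‖c n‖ = ‖φ n - e n‖⁻¹ := fun n => by simp [c]
  have hc0 : ∀ n, c n ≠ 0 := fun n => norm_pos_iff.1 (by rw [hc]; exact inv_pos.2 (hpos n))
  let ψ : ℕ → StrongDual 𝕜 E := fun n => c n • (φ n - e n)
  have hψ : ∀ n, ‖ψ n‖ ≤ 1 := fun n => by
    rw [norm_smul, hc, inv_mul_cancel₀ (hpos n).ne']
  have hψmem : ∀ n, ψ n ∈ p (n + 1) := fun n =>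
    Submodule.smul_mem _ _ (sub_mem (hmem n) (hmono (Nat.le_succ n) (he n)))
  obtain ⟨m, n, hmn, hlt⟩ := exists_lt_norm_sub_comp_lt hS hψ (ε := ε / 2) (by positivity)
  have hμn : μ n ≠ 0 := norm_pos_iff.1 (hε.trans_le (hμ n))
  let d := c n • (e n).comp S + (ψ m).comp S
  have hd : d ∈ p n := add_mem (Submodule.smul_mem _ _ (hinv n _ (he n)))
    (hinv n _ (hmono (Nat.succ_le_of_lt hmn) (hψmem m)))
  -- Modulo `p n` only the multiple of `φ n` survives; as `e n` is nearly the best approximation,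
  -- the norm is at least `ε / 2`.
  have heq : (ψ n - ψ m).comp S = (c n * μ n) • (φ n - (c n * μ n)⁻¹ • d) := by
    rw [smul_sub, smul_inv_smul₀ (mul_ne_zero (hc0 n) hμn), mul_smul, ← hφ]
    ext x
    simp [ψ, d, mul_sub]
    ring
  have hb := hbest n _ (Submodule.smul_mem _ (c n * μ n)⁻¹ hd)
  rw [heq, norm_smul, norm_mul, hc] at hlt
  have h1 : ‖φ n - e n‖⁻¹ * ‖φ n - e n‖ = 1 := inv_mul_cancel₀ (hpos n).ne'
  have h2 : ε * (‖φ n - e n‖⁻¹ * ‖φ n - e n‖)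
      ≤ ‖μ n‖ * (‖φ n - e n‖⁻¹ * (2 * ‖φ n - (c n * μ n)⁻¹ • d‖)) := by
    have := hμ n
    have := hpos n
    gcongr
  rw [h1] at h2
  nlinarith

/-! ### Weakly compact operators -/

/-- Uniform boundedness applies in the bidual, because the dual is complete even when `E` is not. -/
theorem norm_le_of_isCompact_closure_toWeakSpace {E : Type*} [NormedAddCommGroup E]
    [NormedSpace ℂ E] {s : Set E} (hs : IsCompact (closure (toWeakSpace ℂ E '' s))) :
    ∃ C, ∀ y ∈ s, ‖y‖ ≤ C := by
  obtain ⟨C, hC⟩ := banach_steinhaus (g := fun y : s => NormedSpace.inclusionInDoubleDual ℂ E y)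
    fun φ => by
      have hcont : Continuous fun y : WeakSpace ℂ E => φ ((toWeakSpace ℂ E).symm y) :=
        WeakBilin.eval_continuous _ φ
      obtain ⟨C, hC⟩ := (hs.image hcont).isBounded.exists_norm_le
      exact ⟨C, fun y => hC _ ⟨toWeakSpace ℂ E y, subset_closure ⟨y, y.2, rfl⟩, by simp⟩⟩
  refine ⟨C, fun y hy => ?_⟩
  rw [← (NormedSpace.inclusionInDoubleDualLi (𝕜 := ℂ) (E := E)).norm_map y]
  exact hC ⟨y, hy⟩

theorem IsWeaklyCompactOperator.continuous {E G : Type*} [NormedAddCommGroup E] [NormedSpace ℂ E]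
    [NormedAddCommGroup G] [NormedSpace ℂ G] {T : E →ₗ[ℂ] G} (hT : IsWeaklyCompactOperator T) :
    Continuous T := by
  obtain ⟨C, hC⟩ := norm_le_of_isCompact_closure_toWeakSpace hT
  refine AddMonoidHomClass.continuous_of_bound T (2 * C) fun x => ?_
  rcases eq_or_ne x 0 with rfl | hx
  · simp
  have hx' := norm_pos_iff.2 hx
  have h := hC _ ⟨((2 * ‖x‖)⁻¹ : ℂ) • x, ?_, rfl⟩
  · rw [map_smul, norm_smul] at h
    simp only [norm_inv, norm_mul, Complex.norm_real, norm_norm, Complex.norm_ofNat] at h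
    rw [inv_mul_le_iff₀ (by positivity)] at h
    linarith
  · rw [mem_ball_zero_iff, norm_smul]
    simp only [norm_inv, norm_mul, Complex.norm_real, norm_norm, Complex.norm_ofNat]
    rw [inv_mul_lt_iff₀ (by positivity)]
    linarith

theorem IsWeaklyCompactOperator.clm_comp {E G H : Type*} [NormedAddCommGroup E] [NormedSpace ℂ E]
    [NormedAddCommGroup G] [NormedSpace ℂ G] [NormedAddCommGroup H] [NormedSpace ℂ H]
    {T : E → G} (hT : IsWeaklyCompactOperator T) (J : G →L[ℂ] H) :
    IsWeaklyCompactOperator (J ∘ T) := by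
  have hK := hT.image (WeakSpace.map J).continuous
  refine hK.of_isClosed_subset isClosed_closure (closure_minimal ?_ hK.isClosed)
  rintro _ ⟨_, ⟨x, hx, rfl⟩, rfl⟩
  exact ⟨toWeakSpace ℂ G (T x), subset_closure ⟨T x, ⟨x, hx, rfl⟩, rfl⟩, rfl⟩

/-- The square of a weakly compact operator on a normed space with the Dunford–Pettis property
is compact. -/
theorem DunfordPettisProperty.isCompactOperator_comp_self {E : Type*} [NormedAddCommGroup E]
    [NormedSpace ℂ E] (hE : DunfordPettisProperty E) {T : E →ₗ[ℂ] E}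
    (hT : IsWeaklyCompactOperator T) : IsCompactOperator (T ∘ₗ T) := by
  let T' : E →L[ℂ] E := ⟨T, hT.continuous⟩
  -- The Dunford–Pettis property tests only Banach targets, so `T` is sent into the completion;
  -- compactness of `T '' K` pulls back along the embedding `J`.
  let J : E →L[ℂ] UniformSpace.Completion E := UniformSpace.Completion.toComplL
  have hJT := hE _ (J.comp T') (hT.clm_comp J)
  let K : Set E := (toWeakSpace ℂ E).symm '' closure (toWeakSpace ℂ E '' (T '' Metric.ball 0 1))
  have hK : IsCompact (toWeakSpace ℂ E '' K) := by
    rw [image_image]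
    simp only [LinearEquiv.apply_symm_apply, image_id']
    exact hT
  have hTK : IsCompact (T '' K) := by
    have h := hJT K hK
    have hJ : Topology.IsEmbedding J :=
      (UniformSpace.Completion.toComplₗᵢ (𝕜 := ℂ) (E := E)).isometry.isEmbedding
    rw [hJ.isCompact_iff, image_image]
    exact h
  refine ⟨T '' K, hTK, Filter.mem_of_superset (Metric.ball_mem_nhds 0 one_pos) fun x hx => ?_⟩
  exact ⟨T x, ⟨toWeakSpace ℂ E (T x), subset_closure ⟨T x, ⟨x, hx, rfl⟩, rfl⟩, by simp⟩, rfl⟩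

/-! ### Multipliers and point evaluations -/

namespace NSCF

variable {X : Type*} [TopologicalSpace X] {F : Type*} [NormedAddCommGroup F] [NormedSpace ℂ F]
  [NSCF X F] {ω : X → ℂ}

theorem isMultiplier_sq (hω : IsMultiplier F ω) : IsMultiplier F (ω ^ 2) := fun f =>
  ⟨mulOp hω (mulOp hω f), fun x => by
    rw [pointEval_mulOp, pointEval_mulOp, Pi.pow_apply, sq, mul_assoc]⟩

theorem mulOp_comp_mulOp (hω : IsMultiplier F ω) :
    mulOp hω ∘ₗ mulOp hω = mulOp (isMultiplier_sq hω) :=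
  LinearMap.ext fun f => ext_pointEval (X := X) fun x => by
    rw [LinearMap.comp_apply, pointEval_mulOp, pointEval_mulOp, pointEval_mulOp, Pi.pow_apply, sq,
      mul_assoc]

theorem continuous_multiplier (hF : OneIndependent X F) (hω : IsMultiplier F ω) :
    Continuous ω := by
  rw [continuous_iff_continuousAt]
  intro x
  obtain ⟨f, hf⟩ : ∃ f, pointEval F x f ≠ 0 := by
    by_contra! h
    exact hF x (ContinuousLinearMap.ext h)
  have hc : ∀ g : F, Continuous fun y : X => pointEval F y g := fun g =>
    (incl (X := X) g).continuous
  -- Near `x` the multiplier is the quotient of the continuous functions `ω f` and `f`.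
  refine (((hc (mulOp hω f)).continuousAt (x := x)).div (hc f).continuousAt hf).congr ?_
  filter_upwards [(hc f).continuousAt.eventually_ne hf] with y hy
  rw [Pi.div_apply, pointEval_mulOp, mul_div_cancel_right₀ _ hy]

theorem not_linearIndependent_pointEval (hω : IsMultiplier F ω)
    (hc : IsCompactOperator (mulOp (isMultiplier_sq hω))) {ε : ℝ} (hε : 0 < ε) {x : ℕ → X}
    (hx : ∀ n, ε ≤ ‖ω (x n)‖) : ¬ LinearIndependent ℂ fun n => pointEval F (x n) := by
  refine IsCompactOperator.not_linearIndependent_of_comp_eq_smul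
    (S := ContinuousLinearMap.mkOfIsCompactOperator hc) hc (μ := fun n => ω (x n) ^ 2)
    (fun n => ?_) (pow_pos hε 2) fun n => ?_
  · ext f
    exact pointEval_mulOp _ _ _
  · rw [norm_pow]
    exact pow_le_pow_left₀ hε.le (hx n) 2

/-- These are eigenvectors of the algebraic adjoint for distinct eigenvalues, nonzero by
`1`-independence. -/
theorem linearIndependent_pointEval_of_injective (hF : OneIndependent X F)
    (hω : IsMultiplier F ω) {ι : Type*} {x : ι → X} (hx : Function.Injective fun i => ω (x i)) :
    LinearIndependent ℂ fun i => pointEval F (x i) := by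
  let L : StrongDual ℂ F →ₗ[ℂ] Module.Dual ℂ F := ContinuousLinearMap.coeLM ℂ
  refine LinearIndependent.of_comp L (Module.End.eigenvectors_linearIndependent'
    (LinearMap.dualMap (mulOp hω)) (fun i => ω (x i)) hx _ fun i => ⟨?_, fun h => ?_⟩)
  · rw [Module.End.mem_eigenspace_iff]
    ext f
    exact pointEval_mulOp _ _ _
  · exact hF (x i) (ContinuousLinearMap.ext fun f => LinearMap.congr_fun h f)

theorem finite_setOf_le_norm_range (hF : OneIndependent X F) (hω : IsMultiplier F ω)
    (hc : IsCompactOperator (mulOp (isMultiplier_sq hω))) {ε : ℝ} (hε : 0 < ε) :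
    (range ω ∩ {c | ε ≤ ‖c‖}).Finite := by
  by_contra h
  let e := Set.Infinite.natEmbedding _ h
  choose x hx using fun n => (e n).2.1
  refine not_linearIndependent_pointEval hω hc hε (x := x) (fun n => ?_)
    (linearIndependent_pointEval_of_injective hF hω fun m n hmn => ?_)
  · rw [hx]
    exact (e n).2.2
  · refine e.injective (Subtype.ext ?_)
    simpa only [hx] using hmn

theorem finite_setOf_le_norm (hω : IsMultiplier F ω)
    (hc : IsCompactOperator (mulOp (isMultiplier_sq hω)))
    (hli : LinearIndependent ℂ fun x : X => pointEval F x) {ε : ℝ} (hε : 0 < ε) :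
    {x | ε ≤ ‖ω x‖}.Finite := by
  by_contra h
  let e := Set.Infinite.natEmbedding _ h
  exact not_linearIndependent_pointEval hω hc hε (x := fun n => (e n : X)) (fun n => (e n).2)
    (hli.comp (fun n => (e n : X)) (Subtype.coe_injective.comp e.injective))

end NSCF

/-! ### Range and fibres of the multiplier -/

theorem finite_or_exists_injective_tendsto_zero {s : Set ℂ}
    (hs : ∀ ε > 0, (s ∩ {c | ε ≤ ‖c‖}).Finite) :
    s.Finite ∨ ∃ u : ℕ → ℂ, Function.Injective u ∧ range u = s ∧ Tendsto u atTop (𝓝 0) := by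
  refine or_iff_not_imp_left.2 fun hinf => ?_
  have hcount : s.Countable := by
    have : s ⊆ insert 0 (⋃ n : ℕ, s ∩ {c | 1 / ((n : ℝ) + 1) ≤ ‖c‖}) := fun c hc => by
      rcases eq_or_ne c 0 with rfl | h0
      · exact mem_insert _ _
      · obtain ⟨n, hn⟩ := exists_nat_one_div_lt (norm_pos_iff.2 h0)
        exact mem_insert_of_mem _ (mem_iUnion.2 ⟨n, hc, hn.le⟩)
    exact ((countable_iUnion fun n => (hs _ Nat.one_div_pos_of_nat).countable).insert 0).mono this
  have := hcount.to_subtype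
  have : Infinite s := infinite_coe_iff.2 hinf
  obtain ⟨e⟩ := nonempty_equiv_of_countable (α := ℕ) (β := s)
  have hinj : Function.Injective fun n => (e n : ℂ) := Subtype.coe_injective.comp e.injective
  refine ⟨fun n => e n, hinj, ?_, ?_⟩
  · rw [range_comp' (Subtype.val), e.range_eq_univ, image_univ, Subtype.range_coe]
  · rw [← Nat.cofinite_eq_atTop, Metric.tendsto_nhds]
    intro ε hε
    refine ((hs ε hε).preimage hinj.injOn).subset fun n hn => ⟨(e n).2, ?_⟩
    simpa using hn

theorem isClopen_preimage_singleton {X : Type*} [TopologicalSpace X] {ω : X → ℂ}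
    (hcont : Continuous ω) (hfin : ∀ ε > 0, (range ω ∩ {c | ε ≤ ‖c‖}).Finite) {c : ℂ}
    (hc : c ≠ 0) : IsClopen (ω ⁻¹' {c}) := by
  refine ⟨isClosed_singleton.preimage hcont, ?_⟩
  have hc' := norm_pos_iff.2 hc
  have hf := (hfin (‖c‖ / 2) (by positivity)).subset
    (sdiff_subset : _ \ {c} ⊆ range ω ∩ {z | ‖c‖ / 2 ≤ ‖z‖})
  -- The other values of norm at least `‖c‖ / 2` are finitely many; removing them leaves an open set
  -- that meets the range only in `c`, if at all.
  have : ω ⁻¹' {c} = ω ⁻¹' ({z | ‖c‖ / 2 < ‖z‖}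
      ∩ ((range ω ∩ {z | ‖c‖ / 2 ≤ ‖z‖}) \ {c})ᶜ) := by
    ext x
    constructor
    · rintro rfl
      exact ⟨half_lt_self hc', fun h => h.2 rfl⟩
    · rintro ⟨h1, h2⟩
      by_contra h
      exact h2 ⟨⟨mem_range_self x, (show ‖c‖ / 2 < ‖ω x‖ from h1).le⟩, h⟩
  rw [this]
  exact ((isOpen_lt continuous_const continuous_norm).inter hf.isClosed.isOpen_compl).preimage hcont

theorem mainTheorem7 {X : Type*} [TopologicalSpace X] [T2Space X]
    {F : Type*} [NormedAddCommGroup F] [NormedSpace ℂ F] [NSCF X F]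
    (hF : NSCF.OneIndependent X F) (hDP : DunfordPettisProperty F)
    (ω : X → ℂ) (hω : NSCF.IsMultiplier F ω) (hwc : IsWeaklyCompactOperator (NSCF.mulOp hω)) :
    (∃ hω2 : NSCF.IsMultiplier F (ω ^ 2),
      NSCF.mulOp hω ∘ₗ NSCF.mulOp hω = NSCF.mulOp hω2 ∧ IsCompactOperator (NSCF.mulOp hω2)) ∧
    ((range ω).Finite ∨
      ∃ s : ℕ → ℂ, Function.Injective s ∧ range s = range ω ∧ Tendsto s atTop (𝓝 0)) ∧
    (∀ c : ℂ, c ≠ 0 → IsClopen (ω ⁻¹' {c})) ∧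
    (∀ x : X, ∀ y ∈ connectedComponent x, ω y = ω x) ∧
    (ConnectedSpace X → ¬ FiniteDimensional ℂ F → ∀ x : X, ω x = 0) ∧
    (LinearIndependent ℂ (fun x : X => NSCF.pointEval F x) →
      {x : X | ω x ≠ 0}.Countable ∧ ∀ x : X, ω x ≠ 0 → IsOpen ({x} : Set X)) := by
  have hc : IsCompactOperator (NSCF.mulOp (NSCF.isMultiplier_sq hω)) := by
    rw [← NSCF.mulOp_comp_mulOp hω]
    exact hDP.isCompactOperator_comp_self hwc
  have hfin : ∀ ε > 0, (range ω ∩ {c | ε ≤ ‖c‖}).Finite := fun ε hε =>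
    NSCF.finite_setOf_le_norm_range hF hω hc hε
  have hclopen : ∀ c : ℂ, c ≠ 0 → IsClopen (ω ⁻¹' {c}) := fun c h0 =>
    isClopen_preimage_singleton (NSCF.continuous_multiplier hF hω) hfin h0
  have hcomp : ∀ x : X, ∀ y ∈ connectedComponent x, ω y = ω x := fun x y hy => by
    -- The fibre over `0` need not be open, so if `ω x = 0` the clopen fibre through `y` is used.
    rcases eq_or_ne (ω x) 0 with hx | hx
    · by_contra hne
      have hy0 : ω y ≠ 0 := fun h => hne (h.trans hx.symm)
      rw [connectedComponent_eq_iff_mem.symm] at hy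
      exact hne ((hclopen _ hy0).connectedComponent_subset (x := y) rfl
        (hy ▸ mem_connectedComponent : x ∈ connectedComponent y)).symm
    · exact (hclopen _ hx).connectedComponent_subset (x := x) rfl hy
  refine ⟨⟨NSCF.isMultiplier_sq hω, NSCF.mulOp_comp_mulOp hω, hc⟩,
    finite_or_exists_injective_tendsto_zero hfin, hclopen, hcomp, fun _ hdim x => ?_,
    fun hli => ⟨?_, fun x hx => ?_⟩⟩
  · by_contra hx
    refine hdim (FiniteDimensional.of_isCompactOperator_id (𝕜 := ℂ) ?_)
    have hx2 : ω x ^ 2 ≠ 0 := pow_ne_zero 2 hx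
    refine (IsCompactOperator.smul_iff₀ hx2).1 ?_
    -- On connected `X` the multiplier is constant, so a nonzero multiple of the identity would be
    -- compact.
    have heq : ω x ^ 2 • (id : F → F) = NSCF.mulOp (NSCF.isMultiplier_sq hω) :=
      funext fun f => NSCF.ext_pointEval (X := X) fun y => ?_
    · rw [heq]
      exact hc
    rw [NSCF.pointEval_mulOp, Pi.pow_apply, hcomp x y (by simp)]
    exact map_smul (NSCF.pointEval F y) (ω x ^ 2) f
  · have : {x : X | ω x ≠ 0} ⊆ ⋃ n : ℕ, {x | 1 / ((n : ℝ) + 1) ≤ ‖ω x‖} := fun y hy => by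
      obtain ⟨n, hn⟩ := exists_nat_one_div_lt (norm_pos_iff.2 hy)
      exact mem_iUnion.2 ⟨n, hn.le⟩
    exact (countable_iUnion fun n =>
      (NSCF.finite_setOf_le_norm hω hc hli Nat.one_div_pos_of_nat).countable).mono this
  -- The fibre through `x` is open and finite; deleting its other points, a closed set, leaves `{x}`
  -- open.
  · have hf : (ω ⁻¹' {ω x} \ {x}).Finite :=
      (NSCF.finite_setOf_le_norm hω hc hli (norm_pos_iff.2 hx)).subset
        fun y hy => (congrArg norm hy.1).ge
    have : ({x} : Set X) = ω ⁻¹' {ω x} \ (ω ⁻¹' {ω x} \ {x}) := by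
      rw [Set.sdiff_sdiff_right_self, inter_eq_right.2]
      exact singleton_subset_iff.2 rfl
    rw [this]
    exact (hclopen _ hx).isOpen.sdiff hf.isClosed
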